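/- Let $n\ge 0$ and $r\ge 1$ be integers and let $h(x)=c_0+c_1x+\cdots+c_nx^n$ be a real polynomial of degree at most $n$ with nonnegative coefficients. Set $f(x)=\sum_{i=0}^n c_i\,x^i(1+x)^{n-i}$. Then there is a unique real polynomial $\mathcal D_{n,r}(h(x))$ of degree at most $n$ such that, as formal power series, $$f(0)+\sum_{m\ge 1}\bigl(f(rm)-f(rm-1)\bigr)x^m=\frac{\mathcal D_{n,r}(h(x))}{(1-x)^n},$$ and the following hold. (a) The polynomial $\mathcal D_{n,r}(h(x))$ is real-rooted, meaning that it is zero or all its complex roots are real. (b) If $c_0+c_1+\cdots+c_i\le c_n+c_{n-1}+\cdots+c_{n-i}$ for all $0\le i\le\lfloor n/2\rfloor$, then $\mathcal D_{n,r}(h(x))$ has a nonnegative, real-rooted symmetric decomposition with respect to $n$. That is, $\mathcal D_{n,r}(h(x))=a(x)+x\,b(x)$ for real-rooted polynomials $a(x),b(x)\in\mathbb R[x]$ with nonnegative coefficients, of degrees at most $n$ and $n-1$ respectively (with $b=0$ if $n=0$), such that $a(x)=x^na(1/x)$ and $b(x)=x^{n-1}b(1/x)$. -/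

import Mathlib

open Polynomial

/-- A real polynomial is real-rooted if it is zero or all of its complex roots are real. -/
def RealRooted (p : ℝ[X]) : Prop :=
  p = 0 ∨ ∀ z : ℂ, aeval z p = 0 → z.im = 0

/-- All coefficients of `p` are nonnegative. -/
def NonnegCoeffs (p : ℝ[X]) : Prop :=
  ∀ i : ℕ, 0 ≤ p.coeff i

/-- `p = a + x b` is the symmetric decomposition of `p` with respect to `n`: the polynomial `a` has
degree at most `n` and satisfies `a(x) = x ^ n a(1/x)`, and `b` has degree at most `n - 1` and
satisfies `b(x) = x ^ (n - 1) b(1/x)`; for `n = 0` this means `b = 0`. -/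
structure IsSymmetricDecomposition (n : ℕ) (p a b : ℝ[X]) : Prop where
  eq_add : p = a + X * b
  degree_left : a.degree ≤ n
  degree_right : b.degree < n
  symm_left : ∀ i : ℕ, i ≤ n → a.coeff i = a.coeff (n - i)
  symm_right : ∀ i : ℕ, i < n → b.coeff i = b.coeff (n - 1 - i)

/-- `p` has a nonnegative, real-rooted symmetric decomposition with respect to `n`. -/
def HasNonnegRealRootedSymmetricDecomposition (n : ℕ) (p : ℝ[X]) : Prop :=
  ∃ a b : ℝ[X], IsSymmetricDecomposition n p a b ∧
    NonnegCoeffs a ∧ NonnegCoeffs b ∧ RealRooted a ∧ RealRooted b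

/-- The polynomial `f(x) = ∑_{i ≤ n} c_i x ^ i (1 + x) ^ (n - i)`, where `h(x) = ∑_{i ≤ n} c_i x ^ i`. -/
noncomputable def fPoly (n : ℕ) (h : ℝ[X]) : ℝ[X] :=
  ∑ i ∈ Finset.range (n + 1), C (h.coeff i) * X ^ i * (1 + X) ^ (n - i)

/-- The formal power series `f(0) + ∑_{m ≥ 1} (f(r m) - f(r m - 1)) x ^ m`. -/
noncomputable def fSeries (n r : ℕ) (h : ℝ[X]) : PowerSeries ℝ :=
  PowerSeries.mk fun m : ℕ =>
    if m = 0 then (fPoly n h).eval 0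
    else (fPoly n h).eval ((r : ℝ) * (m : ℝ)) - (fPoly n h).eval ((r : ℝ) * (m : ℝ) - 1)

/-- The polynomial `D_{n,r}(h)` of degree at most `n`: the terms of degree at most `n` of the power
series `(f(0) + ∑_{m ≥ 1} (f(r m) - f(r m - 1)) x ^ m) (1 - x) ^ n`. That this series has no further
terms, i.e. that the defining equation of `D_{n,r}(h)` holds, is part of the theorem. -/
noncomputable def coloredSubdivision (n r : ℕ) (h : ℝ[X]) : ℝ[X] :=
  PowerSeries.trunc (n + 1) (fSeries n r h * (1 - PowerSeries.X) ^ n)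

/-! Write t_l for `subdivisionPoly r n l`. Since x^i(1+x)^(n-i) is the difference of two consecutive
basis polynomials for n + 1, summing over a full period telescopes to F(k) - F(k - r), which costs
one factor 1 - x. So each polynomial for n + 1 is a sum of t_l over a window of one period
(`coe_subdivisionPoly`).

Fix z in the upper half plane. Along one period the arguments of t_l(z) increase weakly, in total by
arg z < π, and window sums inherit this (`im_subdivisionPoly_nonneg`). Hence a nonnegative
combination over a period vanishes at z only if all its terms do (`combination_terms_eq_zero`),
which gives (a).

For (b) in degree n + 1, expand the windows (`sum_windows_eq`). With S_j = c_0 + ... + c_j the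
result is V + x(U + b), where V = ∑ S_j t_j over a period, U = ∑ S_{n-k} t_k and b = ∑ B_k t_k over
k ≤ n, and B_k = S_{n+1} - S_k - S_{n-k}. The hypothesis says B_k ≥ 0. Both a = V + xU and b have
palindromic weights, so both are symmetric by `coeff_subdivisionPoly_reflect`. Real-rootedness of b
is as in (a); for a, monotonicity of S gives Im(V conj U) ≥ 0 at z, which excludes V = -zU ≠ 0. -/

/-! ### The window recursion and its period -/

/-- The polynomials `D_{n,r}(x ^ l)` for `l ≤ n`, extended to all `l` so that they form a sequence
with `t (l + (n + 1) r) = x t l`; each one is a sum over a full period of the sequence for `n - 1`. -/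
noncomputable def subdivisionPoly (r : ℕ) : ℕ → ℕ → ℝ[X]
  | 0, l => if r ∣ l then X ^ (l / r) else 0
  | n + 1, l => ∑ j ∈ Finset.range ((n + 1) * r), subdivisionPoly r n (l - l / (n + 2) + j)

lemma subdivisionPoly_succ_of_le (r n : ℕ) {l : ℕ} (hl : l ≤ n + 1) :
    subdivisionPoly r (n + 1) l =
      ∑ j ∈ Finset.range ((n + 1) * r), subdivisionPoly r n (l + j) := by
  have : l / (n + 2) = 0 := Nat.div_eq_of_lt (by omega)
  simp [subdivisionPoly, this]

/-- The last index of a block of length n + 2 and the first of the next carry the same polynomial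
(`truncBasis_self`). The map `l - l / (n + 2)` merges these two, so blocks of length n + 2 become
blocks of length n + 1 and periods match. -/
lemma skip_add_period (n r l : ℕ) :
    (l + (n + 2) * r) - (l + (n + 2) * r) / (n + 2) = l - l / (n + 2) + (n + 1) * r := by
  have h1 : (l + (n + 2) * r) / (n + 2) = l / (n + 2) + r :=
    Nat.add_mul_div_left l r (by omega)
  have h2 : l / (n + 2) ≤ l := Nat.div_le_self _ _
  have h3 : (n + 2) * r = (n + 1) * r + r := by ring
  rw [h1, h3]
  omega

lemma skip_mono (n : ℕ) {l m : ℕ} (h : l ≤ m) : l - l / (n + 2) ≤ m - m / (n + 2) := by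
  obtain ⟨d, rfl⟩ := Nat.exists_eq_add_of_le h
  have h1 : (l + d) / (n + 2) ≤ l / (n + 2) + d := by
    calc (l + d) / (n + 2) ≤ (l + (n + 2) * d) / (n + 2) :=
          Nat.div_le_div_right (by nlinarith)
      _ = l / (n + 2) + d := Nat.add_mul_div_left l d (by omega)
  have h2 : l / (n + 2) ≤ l := Nat.div_le_self _ _
  omega

lemma skip_mul_add (n s i : ℕ) (hi : i ≤ n + 1) :
    ((n + 2) * s + i) - ((n + 2) * s + i) / (n + 2) = (n + 1) * s + i := by
  have h1 : ((n + 2) * s + i) / (n + 2) = s := by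
    rw [Nat.mul_add_div (by omega), Nat.div_eq_of_lt (by omega), add_zero]
  have h3 : (n + 2) * s = (n + 1) * s + s := by ring
  rw [h1, h3]
  omega

lemma subdivisionPoly_add_period {r : ℕ} (hr : 0 < r) (n l : ℕ) :
    subdivisionPoly r n (l + (n + 1) * r) = X * subdivisionPoly r n l := by
  induction n generalizing l with
  | zero =>
    simp only [subdivisionPoly, zero_add, one_mul, Nat.dvd_add_self_right,
      Nat.add_div_right _ hr]
    split_ifs <;> simp [pow_succ']
  | succ n ih =>
    simp only [subdivisionPoly]
    rw [skip_add_period, Finset.mul_sum]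
    refine Finset.sum_congr rfl fun j _ => ?_
    rw [← ih]
    congr 1
    ring

lemma nonnegCoeffs_subdivisionPoly (r n l : ℕ) : NonnegCoeffs (subdivisionPoly r n l) := by
  induction n generalizing l with
  | zero =>
    intro i
    simp only [subdivisionPoly]
    split_ifs
    · rw [coeff_X_pow]; split_ifs <;> norm_num
    · simp
  | succ n ih =>
    intro i
    simp only [subdivisionPoly, finsetSum_coeff]
    exact Finset.sum_nonneg fun j _ => ih _ i

lemma natDegree_subdivisionPoly_le {r : ℕ} (hr : 0 < r) (n l : ℕ) (hl : l < (n + 1) * r) :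
    (subdivisionPoly r n l).natDegree ≤ n := by
  induction n generalizing l with
  | zero =>
    simp only [subdivisionPoly]
    rw [Nat.div_eq_of_lt (by simpa using hl)]
    split_ifs <;> simp
  | succ n ih =>
    simp only [subdivisionPoly]
    refine natDegree_sum_le_of_forall_le _ _ fun j hj => ?_
    rw [Finset.mem_range] at hj
    have hskip : l - l / (n + 2) ≤ (n + 1) * r := by
      have h := skip_mono n hl.le
      have h2 := skip_mul_add n r 0 (by omega)
      simp only [add_zero] at h2
      rw [show (n + 1 + 1) * r = (n + 2) * r from rfl, h2] at h
      exact h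
    by_cases hlt : l - l / (n + 2) + j < (n + 1) * r
    · exact (ih _ hlt).trans (Nat.le_succ n)
    · obtain ⟨d, hd⟩ := Nat.exists_eq_add_of_le (not_lt.mp hlt)
      rw [hd, add_comm, subdivisionPoly_add_period hr]
      refine natDegree_mul_le.trans ?_
      have := ih d (by omega)
      rw [natDegree_X]
      omega

/-! ### Reflection -/

lemma sum_window_eq {r : ℕ} (hr : 0 < r) (n m : ℕ) (hm : m ≤ (n + 1) * r) :
    ∑ j ∈ Finset.range ((n + 1) * r), subdivisionPoly r n (m + j) =
      ∑ j ∈ Finset.Ico m ((n + 1) * r), subdivisionPoly r n j +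
        X * ∑ j ∈ Finset.range m, subdivisionPoly r n j := by
  obtain ⟨d, hd⟩ := Nat.exists_eq_add_of_le hm
  rw [Finset.sum_Ico_eq_sum_range, hd, Nat.add_sub_cancel_left, add_comm m d, Finset.sum_range_add,
    Finset.mul_sum]
  congr 1
  refine Finset.sum_congr rfl fun j _ => ?_
  rw [← subdivisionPoly_add_period hr, hd]
  congr 1
  ring

/-- The reflection l ↦ n + (n+1)r - l carries the window at m to the window at m' moved back by one
period. That period is a factor X, whence a + b rises from n + 1 to n + 2. -/
lemma coeff_sum_window_reflect {r : ℕ} (hr : 0 < r) (n : ℕ)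
    (ih : ∀ l l' a b : ℕ, l + l' = n + (n + 1) * r → a + b = n + 1 →
      (subdivisionPoly r n l).coeff a = (subdivisionPoly r n l').coeff b)
    {m m' a b : ℕ} (hm : m + m' = n + 1 + (n + 1) * r) (hab : a + b = n + 2)
    (hle : m ≤ (n + 1) * r) :
    (∑ j ∈ Finset.range ((n + 1) * r), subdivisionPoly r n (m + j)).coeff a =
      (∑ j ∈ Finset.range ((n + 1) * r), subdivisionPoly r n (m' + j)).coeff b := by
  have hX : ∀ l l', l + l' = n + (n + 1) * r → l < (n + 1) * r →
      (subdivisionPoly r n l).coeff a = (X * subdivisionPoly r n l').coeff b := by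
    intro l l' h hlt
    cases b with
    | zero =>
      rw [coeff_X_mul_zero]
      exact coeff_eq_zero_of_natDegree_lt
        ((natDegree_subdivisionPoly_le hr n l hlt).trans_lt (by omega))
    | succ b => rw [coeff_X_mul]; exact ih _ _ _ _ h (by omega)
  have hX' : ∀ l l', l + l' = n + (n + 1) * r → l < (n + 1) * r →
      (X * subdivisionPoly r n l).coeff a = (subdivisionPoly r n l').coeff b := by
    intro l l' h hlt
    cases a with
    | zero =>
      -- Here b = n + 2, while l' lies below two periods, so the degree is at most n + 1 and both
      -- sides vanish.
      have hl' : l' = (l' - (n + 1) * r) + (n + 1) * r ∨ l' < (n + 1) * r := by omega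
      rw [coeff_X_mul_zero]
      rcases hl' with h' | h'
      · rw [h', subdivisionPoly_add_period hr, show b = (n + 1) + 1 by omega, coeff_X_mul]
        refine (coeff_eq_zero_of_natDegree_lt ((natDegree_subdivisionPoly_le hr n _ ?_).trans_lt
          (by omega))).symm
        have : n + 1 ≤ (n + 1) * r := Nat.le_mul_of_pos_right _ hr
        omega
      · exact (coeff_eq_zero_of_natDegree_lt
          ((natDegree_subdivisionPoly_le hr n l' h').trans_lt (by omega))).symm
    | succ a => rw [coeff_X_mul]; exact ih _ _ _ _ h (by omega)
  rw [sum_window_eq hr n m hle, coeff_add, Finset.mul_sum, finsetSum_coeff, finsetSum_coeff,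
    finsetSum_coeff]
  obtain ⟨d, hd⟩ := Nat.exists_eq_add_of_le hle
  rw [Finset.sum_Ico_eq_sum_range, hd, Nat.add_sub_cancel_left, Finset.sum_range_add, add_comm,
    ← Finset.sum_range_reflect (fun j => (subdivisionPoly r n (m' + j)).coeff b) m,
    ← Finset.sum_range_reflect (fun j => (subdivisionPoly r n (m' + (m + j))).coeff b) d]
  congr 1
  · refine Finset.sum_congr rfl fun j hj => ?_
    rw [Finset.mem_range] at hj
    exact hX' _ _ (by omega) (by omega)
  · refine Finset.sum_congr rfl fun j hj => ?_
    rw [Finset.mem_range] at hj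
    rw [show m' + (m + (d - 1 - j)) = (m' + (d - 1 - j) - d) + (n + 1) * r by omega,
      subdivisionPoly_add_period hr]
    exact hX _ _ (by omega) (by omega)

lemma coeff_subdivisionPoly_reflect {r : ℕ} (hr : 0 < r) (n l l' a b : ℕ)
    (hl : l + l' = n + (n + 1) * r) (hab : a + b = n + 1) :
    (subdivisionPoly r n l).coeff a = (subdivisionPoly r n l').coeff b := by
  induction n generalizing l l' a b with
  | zero =>
    simp only [zero_add, one_mul] at hl hab
    have key : ∀ l l' a b : ℕ, l + l' = r → a + b = 1 → a = 0 →
        (subdivisionPoly r 0 l).coeff a = (subdivisionPoly r 0 l').coeff b := by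
      rintro l l' a b hl hab rfl
      obtain rfl : b = 1 := by omega
      simp only [subdivisionPoly]
      rcases Nat.eq_zero_or_pos l with rfl | h0
      · obtain rfl : l' = r := by omega
        simp [Nat.div_self hr]
      rcases Nat.eq_zero_or_pos l' with rfl | h0'
      · obtain rfl : l = r := by omega
        simp [Nat.div_self hr, coeff_one]
      rw [if_neg (Nat.not_dvd_of_pos_of_lt h0 (by omega)),
        if_neg (Nat.not_dvd_of_pos_of_lt h0' (by omega)), coeff_zero, coeff_zero]
    rcases Nat.eq_zero_or_pos a with h | h
    · exact key _ _ _ _ hl hab h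
    · exact (key _ _ _ _ (by omega) (by omega) (by omega)).symm
  | succ n ih =>
    have hskip : (l - l / (n + 2)) + (l' - l' / (n + 2)) = n + 1 + (n + 1) * r := by
      have hi : l % (n + 2) < n + 2 := Nat.mod_lt _ (by omega)
      have hl0 := Nat.div_add_mod l (n + 2)
      set s := l / (n + 2) with hs
      set i := l % (n + 2) with hi'
      have hsr : s ≤ r := by
        by_contra hcon
        have h3 : (n + 2) * (r + 1) ≤ (n + 2) * s := Nat.mul_le_mul_left _ (by omega)
        have h4 : (n + 2) * (r + 1) = (n + 1 + 1) * r + (n + 2) := by ring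
        omega
      obtain ⟨d, rfl⟩ := Nat.exists_eq_add_of_le hsr
      have hl' : l' = (n + 2) * d + (n + 1 - i) := by
        have h4 : (n + 1 + 1) * (s + d) = (n + 2) * s + (n + 2) * d := by ring
        omega
      have h1 := skip_mul_add n s i (by omega)
      have h2 := skip_mul_add n d (n + 1 - i) (by omega)
      rw [hl0] at h1
      rw [← hl'] at h2
      have h5 : (n + 1) * (s + d) = (n + 1) * s + (n + 1) * d := by ring
      rw [h1, h2, h5]
      omega
    simp only [subdivisionPoly]
    by_cases hle : l - l / (n + 2) ≤ (n + 1) * r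
    · exact coeff_sum_window_reflect hr n ih hskip hab hle
    -- Now the other window starts below n + 1, hence within the first period, and the roles are
    -- exchanged.
    · have : n + 1 ≤ (n + 1) * r := Nat.le_mul_of_pos_right _ hr
      exact (coeff_sum_window_reflect hr n ih (by omega) (by omega) (by omega)).symm

/-! ### Generating functions -/

/-- The function `k ↦ k ^ i (1 + k) ^ (n - i)` on the nonnegative integers, extended by zero. -/
noncomputable def truncBasis (n i : ℕ) (k : ℤ) : ℝ :=
  if k < 0 then 0 else (k : ℝ) ^ i * (1 + (k : ℝ)) ^ (n - i)

/-- The series `∑ (F(r m) - F(r m - 1)) x ^ m`. -/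
noncomputable def differenceSeries (r : ℕ) (F : ℤ → ℝ) : PowerSeries ℝ :=
  PowerSeries.mk fun m : ℕ => F (r * m) - F (r * m - 1)

lemma truncBasis_sub_succ (n i : ℕ) (hi : i ≤ n) (k : ℤ) :
    truncBasis (n + 1) i k - truncBasis (n + 1) (i + 1) k = truncBasis n i k := by
  unfold truncBasis
  split_ifs
  · simp
  · rw [Nat.succ_sub hi, Nat.add_sub_add_right, pow_succ (1 + (k : ℝ))]
    ring

lemma truncBasis_self (n : ℕ) (k : ℤ) :
    truncBasis (n + 1) (n + 1) k = truncBasis (n + 1) 0 (k - 1) := by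
  unfold truncBasis
  by_cases h : k < 0
  · rw [if_pos h, if_pos (by omega)]
  rcases (not_lt.mp h).eq_or_lt with rfl | h'
  · simp
  · rw [if_neg h, if_neg (by omega)]
    simp

/-- Each summand is a difference of consecutive functions for n + 1, also across the end of a block
thanks to `truncBasis_self`. The sum telescopes, and (n+1)r indices amount to a shift of the
argument by r. -/
lemma sum_truncBasis_window (n r m : ℕ) (k : ℤ) :
    ∑ j ∈ Finset.range ((n + 1) * r),
        truncBasis n ((m + j) % (n + 1)) (k - ((m + j) / (n + 1) : ℕ)) =
      truncBasis (n + 1) (m % (n + 1)) (k - (m / (n + 1) : ℕ)) -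
        truncBasis (n + 1) (m % (n + 1)) (k - r - (m / (n + 1) : ℕ)) := by
  have step : ∀ j : ℕ, truncBasis n (j % (n + 1)) (k - (j / (n + 1) : ℕ)) =
      truncBasis (n + 1) (j % (n + 1)) (k - (j / (n + 1) : ℕ)) -
        truncBasis (n + 1) ((j + 1) % (n + 1)) (k - ((j + 1) / (n + 1) : ℕ)) := by
    intro j
    have hj : j % (n + 1) < n + 1 := Nat.mod_lt j (Nat.succ_pos n)
    rw [← truncBasis_sub_succ n _ (by omega)]
    congr 1
    have hdm := Nat.div_add_mod j (n + 1)
    set s := j / (n + 1)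
    set i := j % (n + 1)
    rw [← hdm]
    rcases (Nat.lt_succ_iff.mp hj).eq_or_lt with h | h
    · have e : (n + 1) * s + i + 1 = (n + 1) * (s + 1) := by rw [h]; ring
      rw [e, Nat.mul_mod_right, Nat.mul_div_cancel_left _ (Nat.succ_pos n), h, truncBasis_self]
      congr 1
      push_cast
      ring
    · rw [add_assoc, Nat.mul_add_mod, Nat.mul_add_div (Nat.succ_pos n),
        Nat.mod_eq_of_lt (by omega), Nat.div_eq_of_lt (by omega), add_zero]
  simp_rw [step]
  have tel := Finset.sum_range_sub'
    (fun j => truncBasis (n + 1) ((m + j) % (n + 1)) (k - ((m + j) / (n + 1) : ℕ)))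
    ((n + 1) * r)
  simp only [add_zero, ← add_assoc] at tel
  rw [tel, Nat.add_mul_mod_self_left, Nat.add_mul_div_left _ _ (Nat.succ_pos n)]
  congr 2
  push_cast
  ring

lemma differenceSeries_sum {ι : Type*} (r : ℕ) (s : Finset ι) (F : ι → ℤ → ℝ) :
    ∑ j ∈ s, differenceSeries r (F j) = differenceSeries r (fun k => ∑ j ∈ s, F j k) := by
  ext m
  simp [differenceSeries, Finset.sum_sub_distrib, map_sum]

lemma differenceSeries_sub_shift {r : ℕ} (hr : 0 < r) (F : ℤ → ℝ) (hF : ∀ k < 0, F k = 0) :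
    differenceSeries r (fun k => F k - F (k - r)) =
      (1 - PowerSeries.X) * differenceSeries r F := by
  ext m
  rw [sub_mul, one_mul, map_sub]
  cases m with
  | zero =>
    simp only [differenceSeries, PowerSeries.coeff_mk, PowerSeries.coeff_zero_X_mul]
    rw [hF (_ - (r : ℤ)) (by simp; omega), hF ((r : ℤ) * ((0 : ℕ) : ℤ) - 1 - r) (by simp; omega)]
    ring
  | succ m =>
    simp only [differenceSeries, PowerSeries.coeff_mk, PowerSeries.coeff_succ_X_mul]
    rw [show (r : ℤ) * ((m + 1 : ℕ) : ℤ) - r = r * m by push_cast; ring,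
      show (r : ℤ) * ((m + 1 : ℕ) : ℤ) - 1 - r = r * m - 1 by push_cast; ring]
    ring

lemma coe_subdivisionPoly {r : ℕ} (hr : 0 < r) (n l : ℕ) :
    (subdivisionPoly r n l : PowerSeries ℝ) = (1 - PowerSeries.X) ^ n *
      differenceSeries r (fun k => truncBasis n (l % (n + 1)) (k - (l / (n + 1) : ℕ))) := by
  induction n generalizing l with
  | zero =>
    ext m
    have hr' : (0 : ℤ) < r := by exact_mod_cast hr
    simp only [subdivisionPoly, pow_zero, one_mul, differenceSeries, PowerSeries.coeff_mk,
      zero_add, Nat.div_one, Nat.mod_one, truncBasis, Nat.sub_self, mul_one, Polynomial.coeff_coe]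
    by_cases hd : r ∣ l
    · obtain ⟨q, rfl⟩ := hd
      rw [if_pos (dvd_mul_right _ _), Nat.mul_div_cancel_left _ hr, coeff_X_pow]
      rcases lt_trichotomy m q with h | h | h
      · have : (r : ℤ) * m < r * q := by exact_mod_cast Nat.mul_lt_mul_of_pos_left h hr
        rw [if_neg h.ne, if_pos (by push_cast; omega), if_pos (by push_cast; omega)]
        simp
      · subst h
        rw [if_pos rfl, if_neg (by push_cast; omega), if_pos (by push_cast; omega)]
        simp
      · have : (r : ℤ) * q < r * m := by exact_mod_cast Nat.mul_lt_mul_of_pos_left h hr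
        rw [if_neg h.ne', if_neg (by push_cast; omega), if_neg (by push_cast; omega)]
        simp
    · rw [if_neg hd, coeff_zero]
      have hne : (r : ℤ) * m ≠ l := by
        intro h
        exact hd ⟨m, by exact_mod_cast h.symm⟩
      by_cases h : (r : ℤ) * m - l < 0
      · rw [if_pos h, if_pos (by omega)]; simp
      · rw [if_neg h, if_neg (by omega)]; simp
  | succ n ih =>
    have hw : differenceSeries r
        (fun k => truncBasis (n + 1) (l % (n + 2)) (k - (l / (n + 2) : ℕ))) =
        differenceSeries r (fun k => truncBasis (n + 1) ((l - l / (n + 2)) % (n + 1))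
          (k - ((l - l / (n + 2)) / (n + 1) : ℕ))) := by
      congr 1
      funext k
      have hdm := Nat.div_add_mod l (n + 2)
      have hi := Nat.mod_lt l (show 0 < n + 2 by omega)
      have hsk := skip_mul_add n (l / (n + 2)) (l % (n + 2)) (by omega)
      rw [hdm] at hsk
      rw [hsk]
      set s := l / (n + 2)
      set i := l % (n + 2)
      rw [Nat.mul_add_mod, Nat.mul_add_div (Nat.succ_pos n)]
      rcases (Nat.lt_succ_iff.mp hi).eq_or_lt with h | h
      · rw [h, Nat.mod_self, Nat.div_self (Nat.succ_pos n), truncBasis_self]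
        congr 1
        push_cast
        ring
      · rw [Nat.mod_eq_of_lt h, Nat.div_eq_of_lt h, add_zero]
    rw [show n + 1 + 1 = n + 2 from rfl, hw]
    simp only [subdivisionPoly]
    rw [← Polynomial.coeToPowerSeries.ringHom_apply, map_sum]
    simp only [Polynomial.coeToPowerSeries.ringHom_apply, ih]
    rw [← Finset.mul_sum, differenceSeries_sum]
    simp only [sum_truncBasis_window]
    rw [pow_succ, mul_assoc, ← differenceSeries_sub_shift hr]
    intro k hk
    exact if_pos (by have := Int.natCast_nonneg ((l - l / (n + 2)) / (n + 1)); omega)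

/-- Cutting the basis functions off at negative arguments turns the exceptional term f(0) into F(0)
- F(-1), so it fits the general pattern. -/
lemma fSeries_mul {r : ℕ} (hr : 0 < r) (n : ℕ) (h : ℝ[X]) :
    fSeries n r h * (1 - PowerSeries.X) ^ n =
      ((∑ i ∈ Finset.range (n + 1), C (h.coeff i) * subdivisionPoly r n i : ℝ[X]) :
        PowerSeries ℝ) := by
  have hf : fSeries n r h = ∑ i ∈ Finset.range (n + 1),
      PowerSeries.C (h.coeff i) * differenceSeries r (truncBasis n i) := by
    ext m
    rw [map_sum]
    simp only [fSeries, fPoly, differenceSeries, PowerSeries.coeff_mk, PowerSeries.coeff_C_mul,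
      eval_finsetSum, eval_mul, eval_C, eval_pow, eval_X, eval_add, eval_one, truncBasis]
    rcases Nat.eq_zero_or_pos m with rfl | hm
    · simp
    · have h1 : (1 : ℤ) ≤ (r : ℤ) * m := by
        exact_mod_cast Nat.mul_pos hr hm
      have h2 : ¬ (r : ℤ) * m < 0 := by linarith
      have h3 : ¬ (r : ℤ) * m - 1 < 0 := by linarith
      simp only [if_neg hm.ne', if_neg h2, if_neg h3, ← Finset.sum_sub_distrib]
      refine Finset.sum_congr rfl fun i _ => ?_
      push_cast
      ring
  rw [hf, ← Polynomial.coeToPowerSeries.ringHom_apply, map_sum, Finset.sum_mul]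
  refine Finset.sum_congr rfl fun i hi => ?_
  rw [Finset.mem_range] at hi
  rw [map_mul, Polynomial.coeToPowerSeries.ringHom_apply, Polynomial.coeToPowerSeries.ringHom_apply,
    Polynomial.coe_C, coe_subdivisionPoly hr, Nat.mod_eq_of_lt hi, Nat.div_eq_of_lt hi]
  simp only [Nat.cast_zero, sub_zero]
  ring

lemma degree_combination_le {r : ℕ} (hr : 0 < r) (n K : ℕ) (hK : K ≤ (n + 1) * r) (c : ℕ → ℝ) :
    (∑ i ∈ Finset.range K, C (c i) * subdivisionPoly r n i).degree ≤ n := by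
  refine degree_le_of_natDegree_le (natDegree_sum_le_of_forall_le _ _ fun i hi => ?_)
  rw [Finset.mem_range] at hi
  exact (natDegree_C_mul_le _ _).trans (natDegree_subdivisionPoly_le hr n i (by omega))

lemma coloredSubdivision_eq {r : ℕ} (hr : 0 < r) (n : ℕ) (h : ℝ[X]) :
    coloredSubdivision n r h =
      ∑ i ∈ Finset.range (n + 1), C (h.coeff i) * subdivisionPoly r n i := by
  rw [coloredSubdivision, fSeries_mul hr]
  refine PowerSeries.trunc_coe_eq_self (lt_of_le_of_lt (natDegree_le_of_degree_le
    (degree_combination_le hr n (n + 1) ?_ _)) (Nat.lt_succ_self n))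
  exact Nat.le_mul_of_pos_right _ hr

/-! ### Behaviour on the upper half plane -/

open ComplexConjugate

/-- The hypothesis says arg w_j ≤ arg w_i + arg z in a form insensitive to zero terms. If the last
term is -S, with S the sum of the others, it forces -Im z |S|² ≥ 0, so S = 0. -/
lemma eq_zero_of_sum_eq_zero {z : ℂ} (hz : 0 < z.im) (w : ℕ → ℂ) (K : ℕ)
    (hw : ∀ i j, i ≤ j → j < K → 0 ≤ (z * w i * conj (w j)).im)
    (h0 : ∑ j ∈ Finset.range K, w j = 0) : ∀ j < K, w j = 0 := by
  induction K with
  | zero => intro j hj; omega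
  | succ K ih =>
    rw [Finset.sum_range_succ] at h0
    set S := ∑ j ∈ Finset.range K, w j with hS
    have hwK : w K = -S := by linear_combination h0
    have h1 : 0 ≤ (z * S * conj (w K)).im := by
      rw [hS, Finset.mul_sum, Finset.sum_mul, Complex.im_sum]
      refine Finset.sum_nonneg fun i hi => hw i K (Finset.mem_range.mp hi).le (Nat.lt_succ_self K)
    have h2 : (z * S * conj (w K)).im = -(z.im * Complex.normSq S) := by
      rw [hwK, map_neg, mul_neg, mul_assoc, Complex.mul_conj]
      simp
    have hS0 : S = 0 := by
      rw [← Complex.normSq_eq_zero]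
      have := Complex.normSq_nonneg S
      nlinarith
    intro j hj
    rcases (Nat.lt_succ_iff.mp hj).eq_or_lt with rfl | h
    · rw [hwK, hS0, neg_zero]
    · exact ih (fun i j hij hj => hw i j hij (by omega)) hS0 j h

/-- The arguments of the values of the polynomials `t l` at a point of the upper half plane are
weakly increasing. -/
lemma im_subdivisionPoly_nonneg {r : ℕ} (hr : 0 < r) {z : ℂ} (hz : 0 < z.im) (n l l' : ℕ)
    (h1 : l ≤ l') (h2 : l' ≤ l + (n + 1) * r) :
    0 ≤ (aeval z (subdivisionPoly r n l') * conj (aeval z (subdivisionPoly r n l))).im := by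
  have him : ∀ w : ℂ, 0 ≤ (z * w * conj w).im := by
    intro w
    rw [mul_assoc, Complex.mul_conj]
    simpa using mul_nonneg hz.le (Complex.normSq_nonneg w)
  induction n generalizing l l' with
  | zero =>
    by_cases hl : l' = l + (0 + 1) * r
    · rw [hl, subdivisionPoly_add_period hr, map_mul, aeval_X]
      exact him _
    by_cases hl2 : l' = l
    · rw [hl2, Complex.mul_conj]; simp
    simp only [subdivisionPoly]
    by_cases hd : r ∣ l
    · have : ¬ r ∣ l' := by
        intro hd'
        have := Nat.le_of_dvd (by omega) (Nat.dvd_sub hd' hd)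
        omega
      simp [this]
    · simp [hd]
  | succ n ih =>
    simp only [subdivisionPoly]
    have m1 := skip_mono n h1
    have m2 := skip_mono n h2
    rw [show (n + 1 + 1) * r = (n + 2) * r from rfl, skip_add_period] at m2
    obtain ⟨d, hd⟩ := Nat.exists_eq_add_of_le m1
    rw [hd] at m2 ⊢
    set m := l - l / (n + 2)
    obtain ⟨e, he⟩ := Nat.exists_eq_add_of_le (show d ≤ (n + 1) * r by omega)
    have hp : ∀ j, aeval z (subdivisionPoly r n (m + d + (e + j))) =
        z * aeval z (subdivisionPoly r n (m + j)) := by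
      intro j
      rw [show m + d + (e + j) = m + j + (n + 1) * r by omega, subdivisionPoly_add_period hr,
        map_mul, aeval_X]
    -- The window at m is A followed by B; the window at m + d is B followed by A moved one period,
    -- that is zA. In (B + zA) conj(A + B) the term B conj B is real, z A conj A has imaginary part
    -- Im z |A|², and the induction hypothesis handles the mixed terms.
    set A := ∑ j ∈ Finset.range d, aeval z (subdivisionPoly r n (m + j)) with hA
    set B := ∑ j ∈ Finset.range e, aeval z (subdivisionPoly r n (m + d + j)) with hB
    have e1 : aeval z (∑ j ∈ Finset.range ((n + 1) * r), subdivisionPoly r n (m + j)) = A + B := by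
      rw [map_sum, he, Finset.sum_range_add]
      simp only [hA, hB, add_assoc]
    have e2 : aeval z (∑ j ∈ Finset.range ((n + 1) * r), subdivisionPoly r n (m + d + j)) =
        B + z * A := by
      rw [map_sum, he, add_comm d e, Finset.sum_range_add, hA, Finset.mul_sum]
      simp only [hp, hB]
    have hBA : 0 ≤ (B * conj A).im := by
      rw [hA, hB, map_sum, Finset.sum_mul_sum, Complex.im_sum]
      refine Finset.sum_nonneg fun i hi => ?_
      rw [Complex.im_sum]
      refine Finset.sum_nonneg fun j hj => ?_
      rw [Finset.mem_range] at hi hj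
      exact ih _ _ (by omega) (by omega)
    have hAB : 0 ≤ (z * A * conj B).im := by
      rw [hA, Finset.mul_sum, hB, map_sum, Finset.sum_mul_sum, Complex.im_sum]
      refine Finset.sum_nonneg fun i hi => ?_
      rw [Complex.im_sum]
      refine Finset.sum_nonneg fun j hj => ?_
      rw [Finset.mem_range] at hi hj
      rw [← hp]
      exact ih _ _ (by omega) (by omega)
    have expand : (B + z * A) * conj (A + B) =
        B * conj A + B * conj B + z * A * conj A + z * A * conj B := by
      rw [map_add]; ring
    have hBB : (B * conj B).im = 0 := by rw [Complex.mul_conj]; simp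
    rw [e1, e2, expand]
    simp only [Complex.add_im] at *
    have := him A
    linarith

lemma combination_terms_eq_zero {r : ℕ} (hr : 0 < r) {z : ℂ} (hz : 0 < z.im) (n m K : ℕ)
    (hK : K ≤ (n + 1) * r) (c : ℕ → ℝ) (hc : ∀ i, 0 ≤ c i)
    (h0 : aeval z (∑ i ∈ Finset.range K, C (c i) * subdivisionPoly r n (m + i)) = 0) :
    ∀ i < K, aeval z (C (c i) * subdivisionPoly r n (m + i)) = 0 := by
  rw [map_sum] at h0
  refine eq_zero_of_sum_eq_zero hz _ K (fun i j hij hj => ?_) h0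
  have key := im_subdivisionPoly_nonneg hr hz n (m + j) (m + i + (n + 1) * r) (by omega) (by omega)
  rw [subdivisionPoly_add_period hr, map_mul, aeval_X] at key
  simp only [map_mul, aeval_C, Complex.coe_algebraMap, Complex.conj_ofReal]
  have : z * ((c i : ℂ) * aeval z (subdivisionPoly r n (m + i))) *
      ((c j : ℂ) * conj (aeval z (subdivisionPoly r n (m + j)))) =
      ((c i * c j : ℝ) : ℂ) * (z * aeval z (subdivisionPoly r n (m + i)) *
        conj (aeval z (subdivisionPoly r n (m + j)))) := by
    push_cast; ring
  rw [this, Complex.im_ofReal_mul]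
  exact mul_nonneg (mul_nonneg (hc i) (hc j)) key

lemma C_mul_eq_zero_of_aeval {p : ℝ[X]} {z : ℂ} (hp : aeval z p = 0 → p = 0) (c : ℝ)
    (h : aeval z (C c * p) = 0) : C c * p = 0 := by
  rw [map_mul, mul_eq_zero, aeval_C, Complex.coe_algebraMap, Complex.ofReal_eq_zero] at h
  rcases h with h | h
  · rw [h, C_0, zero_mul]
  · rw [hp h, mul_zero]

/-- Some of these polynomials are zero, for instance when n = 0 and r does not divide l; the nonzero
ones have no zero in the upper half plane. -/
lemma subdivisionPoly_eq_zero_of_aeval {r : ℕ} (hr : 0 < r) {z : ℂ} (hz : 0 < z.im) (n l : ℕ)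
    (h0 : aeval z (subdivisionPoly r n l) = 0) : subdivisionPoly r n l = 0 := by
  induction n generalizing l with
  | zero =>
    simp only [subdivisionPoly] at h0 ⊢
    split_ifs at h0 ⊢ with h
    · rw [map_pow, aeval_X] at h0
      have := eq_zero_of_pow_eq_zero h0
      simp [this] at hz
    · rfl
  | succ n ih =>
    simp only [subdivisionPoly] at h0 ⊢
    refine Finset.sum_eq_zero fun j hj => ih _ ?_
    have := combination_terms_eq_zero hr hz n (l - l / (n + 2)) ((n + 1) * r) le_rfl
      (fun _ => 1) (fun _ => zero_le_one) (by simpa using h0) j (Finset.mem_range.mp hj)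
    simpa using this

lemma combination_eq_zero_of_aeval {r : ℕ} (hr : 0 < r) {z : ℂ} (hz : 0 < z.im) (n K : ℕ)
    (hK : K ≤ (n + 1) * r) (c : ℕ → ℝ) (hc : ∀ i, 0 ≤ c i)
    (h0 : aeval z (∑ i ∈ Finset.range K, C (c i) * subdivisionPoly r n i) = 0) :
    ∑ i ∈ Finset.range K, C (c i) * subdivisionPoly r n i = 0 := by
  refine Finset.sum_eq_zero fun i hi => C_mul_eq_zero_of_aeval
    (subdivisionPoly_eq_zero_of_aeval hr hz n i) _ ?_
  have := combination_terms_eq_zero hr hz n 0 K hK c hc (by simpa using h0) i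
    (Finset.mem_range.mp hi)
  simpa using this

lemma realRooted_of_upperHalfPlane {p : ℝ[X]}
    (hp : ∀ z : ℂ, 0 < z.im → aeval z p = 0 → p = 0) : RealRooted p := by
  by_cases h : p = 0
  · exact Or.inl h
  refine Or.inr fun z hz => ?_
  by_contra hne
  rcases lt_or_gt_of_ne hne with hlt | hgt
  · refine h (hp (conj z) (by simpa using hlt) ?_)
    rw [aeval_conj, hz, map_zero]
  · exact h (hp z hgt hz)

lemma realRooted_combination {r : ℕ} (hr : 0 < r) (n K : ℕ)
    (hK : K ≤ (n + 1) * r) (c : ℕ → ℝ) (hc : ∀ i, 0 ≤ c i) :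
    RealRooted (∑ i ∈ Finset.range K, C (c i) * subdivisionPoly r n i) :=
  realRooted_of_upperHalfPlane fun _ hz => combination_eq_zero_of_aeval hr hz n K hK c hc

lemma nonnegCoeffs_combination (r n K : ℕ) (c : ℕ → ℝ) (hc : ∀ i < K, 0 ≤ c i) :
    NonnegCoeffs (∑ i ∈ Finset.range K, C (c i) * subdivisionPoly r n i) := by
  intro j
  simp only [finsetSum_coeff, coeff_C_mul]
  exact Finset.sum_nonneg fun i hi => mul_nonneg (hc i (Finset.mem_range.mp hi))
    (nonnegCoeffs_subdivisionPoly r n i j)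

/-! ### The symmetric decomposition -/

/-- A double sum against an antisymmetric kernel, nonnegative above the
diagonal, is nonnegative if the ratio of the weights `v / u` is increasing. -/
lemma sum_antisymm_nonneg (n : ℕ) (u v : ℕ → ℝ) (M : ℕ → ℕ → ℝ) (hanti : ∀ k l, M k l = -M l k)
    (hM : ∀ k l, k < l → l < n → 0 ≤ M k l)
    (huv : ∀ k l, k < l → l < n → u l * v k ≤ u k * v l) :
    0 ≤ ∑ k ∈ Finset.range n, ∑ l ∈ Finset.range n, u k * v l * M k l := by
  have hsw : ∑ k ∈ Finset.range n, ∑ l ∈ Finset.range n, u k * v l * M k l =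
      ∑ k ∈ Finset.range n, ∑ l ∈ Finset.range n, -(u l * v k * M k l) := by
    rw [Finset.sum_comm]
    refine Finset.sum_congr rfl fun k _ => Finset.sum_congr rfl fun l _ => ?_
    rw [hanti]; ring
  have h2 : 0 ≤ ∑ k ∈ Finset.range n, ∑ l ∈ Finset.range n, u k * v l * M k l +
      ∑ k ∈ Finset.range n, ∑ l ∈ Finset.range n, u k * v l * M k l := by
    nth_rewrite 2 [hsw]
    rw [← Finset.sum_add_distrib]
    refine Finset.sum_nonneg fun k hk => ?_
    rw [← Finset.sum_add_distrib]
    refine Finset.sum_nonneg fun l hl => ?_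
    rw [Finset.mem_range] at hk hl
    rw [show u k * v l * M k l + -(u l * v k * M k l) = (u k * v l - u l * v k) * M k l by ring]
    rcases lt_trichotomy k l with h | rfl | h
    · exact mul_nonneg (sub_nonneg.mpr (huv k l h hl)) (hM k l h hl)
    · simp
    · refine mul_nonneg_of_nonpos_of_nonpos (sub_nonpos.mpr ?_) ?_
      · linarith [huv l k h hk]
      · rw [hanti]; linarith [hM l k h hk]
  linarith

/-- The symmetric part `a` of the decomposition `a + x b`. -/
lemma realRooted_symmetricPart {r : ℕ} (hr : 0 < r) (n : ℕ) (S : ℕ → ℝ) (hS0 : ∀ i, 0 ≤ S i)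
    (hS : Monotone S) :
    RealRooted (∑ j ∈ Finset.range ((n + 1) * r), C (S j) * subdivisionPoly r n j +
      X * ∑ k ∈ Finset.range (n + 1), C (S (n - k)) * subdivisionPoly r n k) := by
  have hle : n + 1 ≤ (n + 1) * r := Nat.le_mul_of_pos_right _ hr
  refine realRooted_of_upperHalfPlane fun z hz h0 => ?_
  set V := ∑ j ∈ Finset.range ((n + 1) * r), C (S j) * subdivisionPoly r n j with hV
  set U := ∑ k ∈ Finset.range (n + 1), C (S (n - k)) * subdivisionPoly r n k with hU
  set M : ℕ → ℕ → ℝ := fun k l =>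
    (aeval z (subdivisionPoly r n l) * conj (aeval z (subdivisionPoly r n k))).im with hMdef
  have him : (aeval z V * conj (aeval z U)).im =
      ∑ k ∈ Finset.range (n + 1), ∑ l ∈ Finset.range ((n + 1) * r), S (n - k) * S l * M k l := by
    rw [hV, hU, map_sum, map_sum, map_sum, Finset.sum_mul_sum, Finset.sum_comm, Complex.im_sum]
    simp only [Complex.im_sum]
    refine Finset.sum_congr rfl fun k _ => Finset.sum_congr rfl fun l _ => ?_
    simp only [map_mul, aeval_C, Complex.coe_algebraMap, Complex.conj_ofReal, hMdef]
    rw [← Complex.im_ofReal_mul]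
    congr 1
    push_cast
    ring
  -- A zero of V + XU at z would make this imaginary part equal to -Im z |U|². For l ≤ n the kernel
  -- is antisymmetric and S_l / S_{n-l} increases; for l > n every term is nonnegative.
  have hpos : 0 ≤ (aeval z V * conj (aeval z U)).im := by
    rw [him]
    obtain ⟨d, hd⟩ := Nat.exists_eq_add_of_le hle
    simp only [hd, Finset.sum_range_add _ (n + 1) d]
    rw [Finset.sum_add_distrib]
    refine add_nonneg (sum_antisymm_nonneg (n + 1) (fun k => S (n - k)) S M ?_ ?_ ?_) ?_
    · intro k l
      simp only [hMdef, Complex.mul_im, Complex.conj_im, Complex.conj_re]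
      ring
    · intro k l hkl hl
      exact im_subdivisionPoly_nonneg hr hz n k l hkl.le (by omega)
    · intro k l hkl hl
      exact mul_le_mul (hS (by omega)) (hS hkl.le) (hS0 _) (hS0 _)
    · refine Finset.sum_nonneg fun k hk => Finset.sum_nonneg fun j hj => ?_
      rw [Finset.mem_range] at hk hj
      exact mul_nonneg (mul_nonneg (hS0 _) (hS0 _))
        (im_subdivisionPoly_nonneg hr hz n k _ (by omega) (by omega))
  rw [map_add, map_mul, aeval_X] at h0
  have hVU : aeval z V = -(z * aeval z U) := by linear_combination h0
  have hU0 : aeval z U = 0 := by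
    rw [hVU, neg_mul, mul_assoc, Complex.mul_conj] at hpos
    rw [← Complex.normSq_eq_zero]
    have h3 := Complex.normSq_nonneg (aeval z U)
    simp at hpos
    nlinarith
  have hV0 : aeval z V = 0 := by rw [hVU, hU0]; simp
  have hV1 : V = 0 := combination_eq_zero_of_aeval hr hz n _ le_rfl S hS0 hV0
  have hU1 : U = 0 :=
    combination_eq_zero_of_aeval hr hz n _ hle (fun k => S (n - k)) (fun _ => hS0 _) hU0
  rw [hV1, hU1, mul_zero, add_zero]

/-- The window at i contains t_j itself if i ≤ j, and its translate X t_j if j < i; exchanging the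
sums collects partial sums of c. -/
lemma sum_windows_eq {r : ℕ} (hr : 0 < r) (n : ℕ) (c : ℕ → ℝ) :
    ∑ i ∈ Finset.range (n + 2), C (c i) * subdivisionPoly r (n + 1) i =
      ∑ j ∈ Finset.range ((n + 1) * r),
        C (∑ i ∈ Finset.range (n + 2) with i ≤ j, c i) * subdivisionPoly r n j +
      X * ∑ j ∈ Finset.range (n + 1),
        C (∑ i ∈ Finset.range (n + 2) with j < i, c i) * subdivisionPoly r n j := by
  have hle : n + 1 ≤ (n + 1) * r := Nat.le_mul_of_pos_right _ hr
  have h1 : ∀ i ∈ Finset.range (n + 2), C (c i) * subdivisionPoly r (n + 1) i =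
      ∑ j ∈ Finset.range ((n + 1) * r), (if i ≤ j then C (c i) * subdivisionPoly r n j else 0) +
      X * ∑ j ∈ Finset.range (n + 1), (if j < i then C (c i) * subdivisionPoly r n j else 0) := by
    intro i hi
    rw [Finset.mem_range] at hi
    have e1 : {j ∈ Finset.range ((n + 1) * r) | i ≤ j} = Finset.Ico i ((n + 1) * r) := by
      ext j
      simp only [Finset.mem_filter, Finset.mem_range, Finset.mem_Ico]
      omega
    have e2 : {j ∈ Finset.range (n + 1) | j < i} = Finset.range i := by
      ext j
      simp only [Finset.mem_filter, Finset.mem_range]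
      omega
    rw [subdivisionPoly_succ_of_le r n (by omega), sum_window_eq hr n i (by omega),
      ← Finset.sum_filter, ← Finset.sum_filter, e1, e2, mul_add, ← Finset.mul_sum,
      ← Finset.mul_sum, mul_left_comm]
  rw [Finset.sum_congr rfl h1, Finset.sum_add_distrib, ← Finset.mul_sum, Finset.sum_comm,
    Finset.sum_comm (s := Finset.range (n + 2)) (t := Finset.range (n + 1))]
  simp only [Finset.sum_filter, map_sum, Finset.sum_mul, apply_ite C, ite_mul, C_0, zero_mul]

lemma hasSymmetricDecomposition_succ {r : ℕ} (hr : 0 < r) (n : ℕ) (c : ℕ → ℝ) (hc : ∀ i, 0 ≤ c i)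
    (hc0 : ∀ i, n + 1 < i → c i = 0)
    (hdom : ∀ i : ℕ, i ≤ (n + 1) / 2 →
      ∑ j ∈ Finset.range (i + 1), c j ≤ ∑ j ∈ Finset.range (i + 1), c (n + 1 - j)) :
    HasNonnegRealRootedSymmetricDecomposition (n + 1)
      (∑ i ∈ Finset.range (n + 2), C (c i) * subdivisionPoly r (n + 1) i) := by
  have hle : n + 1 ≤ (n + 1) * r := Nat.le_mul_of_pos_right _ hr
  set S : ℕ → ℝ := fun j => ∑ i ∈ Finset.range (j + 1), c i with hSdef
  have hS0 : ∀ i, 0 ≤ S i := fun i => Finset.sum_nonneg fun _ _ => hc _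
  have hSmono : Monotone S := fun i j hij =>
    Finset.sum_le_sum_of_subset_of_nonneg (Finset.range_mono (by omega)) fun _ _ _ => hc _
  set B : ℕ → ℝ := fun k => S (n + 1) - S k - S (n - k) with hBdef
  have hBsymm : ∀ k ≤ n, B (n - k) = B k := by
    intro k hk
    simp only [hBdef]
    rw [show n - (n - k) = k by omega]
    ring
  have hlast : ∀ k ≤ n, ∑ j ∈ Finset.range (k + 1), c (n + 1 - j) = S (n + 1) - S (n - k) := by
    intro k hk
    have hsplit : S (n + 1) = S (n - k) + ∑ j ∈ Finset.range (k + 1), c (n - k + 1 + j) := by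
      simp only [hSdef]
      rw [← Finset.sum_range_add]
      congr 2
      omega
    rw [hsplit, add_sub_cancel_left, ← Finset.sum_range_reflect]
    refine Finset.sum_congr rfl fun j hj => ?_
    rw [Finset.mem_range] at hj
    congr 1
    omega
  have hB0 : ∀ k < n + 1, 0 ≤ B k := by
    have key : ∀ k ≤ n, k ≤ (n + 1) / 2 → 0 ≤ B k := by
      intro k hk hk2
      have := hdom k hk2
      rw [hlast k hk] at this
      simp only [hBdef]
      linarith
    intro k hk
    by_cases h : k ≤ (n + 1) / 2
    · exact key k (by omega) h
    · rw [← hBsymm k (by omega)]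
      exact key (n - k) (by omega) (by omega)
  set V := ∑ j ∈ Finset.range ((n + 1) * r), C (S j) * subdivisionPoly r n j with hV
  set U := ∑ k ∈ Finset.range (n + 1), C (S (n - k)) * subdivisionPoly r n k with hU
  set b := ∑ k ∈ Finset.range (n + 1), C (B k) * subdivisionPoly r n k with hb
  have hVdeg : V.degree ≤ n := degree_combination_le hr n _ le_rfl S
  have hUdeg : U.degree ≤ n := degree_combination_le hr n _ hle fun k => S (n - k)
  have hbdeg : b.degree ≤ n := degree_combination_le hr n _ hle B
  have hpre : ∀ j, ∑ i ∈ Finset.range (n + 2) with i ≤ j, c i = S j := by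
    intro j
    simp only [hSdef]
    refine Finset.sum_subset (fun i => ?_) fun i hi hi' => hc0 i ?_
    · simp only [Finset.mem_filter, Finset.mem_range]; omega
    · simp only [Finset.mem_filter, Finset.mem_range] at hi hi'; omega
  have hsuf : ∀ j, ∑ i ∈ Finset.range (n + 2) with j < i, c i = S (n + 1) - S j := by
    intro j
    rw [← hpre j, eq_sub_iff_add_eq, add_comm]
    simp only [← not_le]
    exact Finset.sum_filter_add_sum_filter_not _ _ _
  have hVU : ∀ a a', a + a' = n + 1 → (V + X * U).coeff a = (V + X * U).coeff a' := by
    -- V + XU is one sum over (n+1)r + (n+1) consecutive indices, since X t_k has index k + (n+1)r.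
    -- Its weights are palindromic because S is constant from n + 1 on.
    set w : ℕ → ℝ := fun j => if j < (n + 1) * r then S j else S (n + (n + 1) * r - j) with hw
    have hSconst : ∀ j, n + 1 ≤ j → S j = S (n + 1) := fun j hj => by
      refine (Finset.sum_subset (Finset.range_mono (by omega)) fun i _ hi => hc0 i ?_).symm
      rw [Finset.mem_range] at hi
      omega
    have hwsymm : ∀ j < (n + 1) * r + (n + 1), w ((n + 1) * r + (n + 1) - 1 - j) = w j := by
      intro j hj
      simp only [hw]
      split_ifs with h1 h2 h2
      · rw [hSconst _ (show n + 1 ≤ j by omega), hSconst _ (by omega)]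
      · congr 1; omega
      · congr 1; omega
      · omega
    have hsum : V + X * U =
        ∑ j ∈ Finset.range ((n + 1) * r + (n + 1)), C (w j) * subdivisionPoly r n j := by
      rw [Finset.sum_range_add, hV, hU, Finset.mul_sum]
      congr 1
      · refine Finset.sum_congr rfl fun j hj => ?_
        simp only [hw, if_pos (Finset.mem_range.mp hj)]
      · refine Finset.sum_congr rfl fun j _ => ?_
        rw [add_comm _ j, subdivisionPoly_add_period hr]
        simp only [hw]
        rw [if_neg (by omega), show n + (n + 1) * r - (j + (n + 1) * r) = n - j by omega]
        ring
    intro a a' ha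
    rw [hsum, finsetSum_coeff, finsetSum_coeff, ← Finset.sum_range_reflect]
    refine Finset.sum_congr rfl fun j hj => ?_
    rw [Finset.mem_range] at hj
    rw [coeff_C_mul, coeff_C_mul, hwsymm j hj]
    congr 1
    exact coeff_subdivisionPoly_reflect hr n _ _ _ _ (by omega) ha
  refine ⟨V + X * U, b, ⟨?_, ?_, ?_, ?_, ?_⟩, ?_, ?_, ?_, ?_⟩
  · rw [sum_windows_eq hr, add_assoc, ← mul_add, hU, hb, ← Finset.sum_add_distrib]
    simp only [hpre, hsuf, ← add_mul, ← C_add]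
    congr 2
    refine Finset.sum_congr rfl fun k _ => ?_
    simp only [hBdef]
    congr 2
    ring
  · refine (degree_add_le _ _).trans (max_le (hVdeg.trans (by exact_mod_cast Nat.le_succ n)) ?_)
    rw [degree_mul, degree_X, add_comm]
    push_cast
    gcongr
  · exact hbdeg.trans_lt (by exact_mod_cast Nat.lt_succ_self n)
  · intro i hi
    exact hVU _ _ (by omega)
  · intro i hi
    rw [hb, finsetSum_coeff, finsetSum_coeff, ← Finset.sum_range_reflect]
    refine Finset.sum_congr rfl fun k hk => ?_
    rw [Finset.mem_range] at hk
    rw [coeff_C_mul, coeff_C_mul, show n + 1 - 1 - k = n - k by omega, hBsymm k (by omega)]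
    congr 1
    -- The reflection of t_{n-k} is X t_k; cancelling X lowers the centre of symmetry to that of
    -- degree n.
    rw [coeff_subdivisionPoly_reflect hr n (n - k) (k + (n + 1) * r) i (n + 1 - i) (by omega)
      (by omega), subdivisionPoly_add_period hr, show n + 1 - i = n + 1 - 1 - i + 1 by omega,
      coeff_X_mul]
  · intro i
    rw [coeff_add]
    refine add_nonneg (nonnegCoeffs_combination r n _ S (fun i _ => hS0 i) i) ?_
    cases i with
    | zero => simp
    | succ i =>
      rw [coeff_X_mul]
      exact nonnegCoeffs_combination r n _ (fun k => S (n - k)) (fun _ _ => hS0 _) i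
  · exact nonnegCoeffs_combination r n _ B hB0
  · exact realRooted_symmetricPart hr n S hS0 hSmono
  -- `realRooted_combination` asks for weights nonnegative at every index, but B may be negative
  -- beyond n, hence the truncation at 0.
  · have e : b = ∑ k ∈ Finset.range (n + 1), C (max (B k) 0) * subdivisionPoly r n k :=
      Finset.sum_congr rfl fun k hk => by rw [max_eq_left (hB0 k (Finset.mem_range.mp hk))]
    rw [e]
    exact realRooted_combination hr n _ hle _ fun _ => le_max_right _ _

theorem theorem1p3 (n r : ℕ) (hr : 0 < r) (h : ℝ[X]) (hdeg : h.degree ≤ n)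
    (hnonneg : NonnegCoeffs h) :
    -- the defining equation of `D_{n,r}(h)`, a polynomial of degree at most `n`
    ((coloredSubdivision n r h).degree ≤ n ∧
      fSeries n r h =
        (coloredSubdivision n r h : PowerSeries ℝ) * ((1 - PowerSeries.X) ^ n)⁻¹) ∧
    -- (a)
    RealRooted (coloredSubdivision n r h) ∧
    -- (b)
    ((∀ i : ℕ, i ≤ n / 2 →
        ∑ j ∈ Finset.range (i + 1), h.coeff j ≤ ∑ j ∈ Finset.range (i + 1), h.coeff (n - j)) →
      HasNonnegRealRootedSymmetricDecomposition n (coloredSubdivision n r h)) := by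
  have hle : n + 1 ≤ (n + 1) * r := Nat.le_mul_of_pos_right _ hr
  rw [coloredSubdivision_eq hr]
  refine ⟨⟨degree_combination_le hr n _ hle _, ?_⟩, realRooted_combination hr n _ hle _ hnonneg, ?_⟩
  · rw [PowerSeries.eq_mul_inv_iff_mul_eq (by simp), fSeries_mul hr]
  · intro hdom
    cases n with
    | succ n =>
      exact hasSymmetricDecomposition_succ hr n h.coeff hnonneg
        (fun i hi => coeff_eq_zero_of_degree_lt (hdeg.trans_lt (by exact_mod_cast hi))) hdom
    | zero =>
      have e : ∑ i ∈ Finset.range (0 + 1), C (h.coeff i) * subdivisionPoly r 0 i =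
          C (h.coeff 0) := by simp [subdivisionPoly]
      rw [e]
      refine ⟨C (h.coeff 0), 0, ⟨by simp, degree_C_le, by simp, ?_, by simp⟩, ?_, ?_, ?_,
        Or.inl rfl⟩
      · intro i hi
        obtain rfl : i = 0 := by omega
        rfl
      · intro i
        rw [coeff_C]
        split_ifs
        · exact hnonneg 0
        · exact le_rfl
      · intro i; simp
      · rw [← e]
        exact realRooted_combination hr 0 _ hle _ hnonneg
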